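/- For $n\ge 0$, $p\ge 1$ and a root of unity $z\in\mathbb{C}$ put $\zeta_n(p;z)=\sum_{k=1}^n \frac{z^k}{k^p}$ and, for $(p,z)\neq(1,1)$, let $$\mathrm{Li}_p(z)=\sum_{n=1}^\infty\frac{z^n}{n^p},\qquad \mathrm{ti}_p(z)=\sum_{n=1}^\infty\frac{z^n}{(n-1/2)^p}.$$ For $p,q\ge 1$ and roots of unity $w,z$ put $$R_{p;q}(w;z)=\sum_{n=0}^\infty\frac{\zeta_n(p;w)}{(n+1/2)^q}\,z^n .$$ All infinite series are understood as limits of their partial sums. **Theorem.** Let $x,y$ be (complex) roots of unity and let $p,q\ge 1$ be integers with $(p,y)\neq(1,1)$ and $(q,xy)\neq(1,1)$. Then the series defining $R_{p;q}(y;(xy)^{-1})$ and $R_{p;q}(y^{-1};xy)$ converge, and $$\begin{aligned} &(xy)^{-1}R_{p;q}\big(y;(xy)^{-1}\big)-(-1)^{p+q}R_{p;q}\big(y^{-1};xy\big)\\ &=\mathrm{Li}_p(y)\,\mathrm{ti}_q\big((xy)^{-1}\big)+(-1)^q(xy)^{-1}\mathrm{Li}_p(y)\,\mathrm{ti}_q(xy)+(-1)^q\binom{p+q-1}{p}(xy)^{-1}\mathrm{ti}_{p+q}(xy)\\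 &\quad+(-1)^q(xy)^{-1}\sum_{m=0}^{p-1}\binom{p+q-m-2}{q-1}\Big((-1)^m\mathrm{Li}_{m+1}(x)-\mathrm{Li}_{m+1}(x^{-1})\Big)\mathrm{ti}_{p+q-m-1}(xy)\\ &\quad+(-1)^q y^{-1}\sum_{m=0}^{q-1}\binom{p+q-m-2}{p-1}\,\mathrm{ti}_{p+q-m-1}(y)\Big((-1)^m\mathrm{ti}_{m+1}(x^{-1})-x^{-1}\mathrm{ti}_{m+1}(x)\Big), \end{aligned}$$ where for $x=1$ the two brackets with $m=0$, namely $\mathrm{Li}_1(x)-\mathrm{Li}_1(x^{-1})$ and $\mathrm{ti}_1(x^{-1})-x^{-1}\mathrm{ti}_1(x)$, are read as $0$. -/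

import Mathlib

open Filter Topology

namespace CyclotomicEuler

/-- The finite polylogarithm sum `ζ_n(p; x) = ∑_{k=1}^n x^k / k^p`. -/
noncomputable def zetaSum (n p : ℕ) (x : ℂ) : ℂ :=
  ∑ k ∈ Finset.Icc 1 n, x ^ k / (k : ℂ) ^ p

/-- The finite `t`-polylogarithm sum `t_n(p; x) = ∑_{k=1}^n x^k / (k - 1/2)^p`. -/
noncomputable def tSum (n p : ℕ) (x : ℂ) : ℂ :=
  ∑ k ∈ Finset.Icc 1 n, x ^ k / ((k : ℂ) - 1 / 2) ^ p

/-- The polylogarithm `Li_p(x) = lim_n ζ_n(p; x)`. The limit of partial sums is used because the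
series converges only conditionally for `p = 1` and `x ≠ 1` on the unit circle. -/
noncomputable def Li (p : ℕ) (x : ℂ) : ℂ :=
  limUnder atTop (fun n : ℕ => zetaSum n p x)

/-- The `t`-polylogarithm `ti_p(x) = lim_n t_n(p; x)`. -/
noncomputable def ti (p : ℕ) (x : ℂ) : ℂ :=
  limUnder atTop (fun n : ℕ => tSum n p x)

/-- The partial sum `∑_{n=0}^{N-1} ζ_n(p; y) z^n / (n + 1/2)^q` of a linear cyclotomic Euler
`R`-sum. -/
noncomputable def RSum (N p q : ℕ) (y z : ℂ) : ℂ :=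
  ∑ n ∈ Finset.range N, zetaSum n p y / ((n : ℂ) + 1 / 2) ^ q * z ^ n

/-- The linear cyclotomic Euler `R`-sum
`R_{p;q}(y; z) = ∑_{n ≥ 0} ζ_n(p; y) z^n / (n + 1/2)^q`, as the limit of its partial sums. -/
noncomputable def R (p q : ℕ) (y z : ℂ) : ℂ :=
  limUnder atTop (fun N : ℕ => RSum N p q y z)

end CyclotomicEuler

namespace CyclotomicEuler

/-! ### Partial fractions -/

/-! Put `z = x * y` and evaluate in two ways the symmetric bilateral sum over n of z^(-(n+1))
(n+1/2)^(-q) T(n), where T(n) is the tail of y^k / k^p over all nonzero integers k > n.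

Folding n with -(n+1) turns T into `Li p y` minus or plus a finite sum, so the value is a product of
`Li` and `ti` terms minus the combination of `R`-sums to be computed (`symSum_tail`).

Alternatively write k = n+1+i and fix i ≥ 0. The weights collapse to x^(-(n+1)) y^i, and n+1/2 and k
differ by the constant i+1/2. Partial fractions (`pow_mul_pow_eq_pfrac`) then reduce the sum over n
to bilateral sums in x alone, which give the brackets; the powers of (i+1/2)⁻¹ sum over i to `ti` at
y or x * y. The excluded index k = 0 leaves the binomial multiple of `ti (p + q) (x * y)`.

The delicate point is the interchange of the two limits (`tendsto_inner_limits`), since the series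
may converge only conditionally. After M values of i the error is the bilateral sum with T(n+M) in
place of T(n), and it is shown to vanish as M grows. -/

theorem sum_multichoose (p q : ℕ) :
    ∑ m ∈ Finset.range (q + 1), Nat.multichoose p m = (p + q).choose p := by
  induction q with
  | zero => simp
  | succ q ih =>
    rw [Finset.sum_range_succ, ih]
    cases p with
    | zero => simp
    | succ p =>
      rw [Nat.multichoose_eq, show p + 1 + (q + 1) - 1 = p + 1 + q by omega,
        show p + 1 + (q + 1) = (p + 1 + q) + 1 by omega, Nat.choose_succ_succ (p + 1 + q) p,
        ← Nat.choose_symm_of_eq_add (show p + 1 + q = (q + 1) + p by omega), add_comm]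

/-- The part of the partial fraction decomposition of `α ^ q * β ^ p` in powers of `α`. -/
noncomputable def pfrac (σ α : ℂ) (p q : ℕ) : ℂ :=
  ∑ m ∈ Finset.range q, (-1) ^ m * (Nat.multichoose p m : ℂ) * σ ^ (p + m) * α ^ (q - m)

theorem pfrac_zero_right (σ α : ℂ) (p : ℕ) : pfrac σ α p 0 = 0 := by simp [pfrac]

theorem pfrac_zero_left (σ α : ℂ) (q : ℕ) : pfrac σ α 0 (q + 1) = α ^ (q + 1) := by
  rw [pfrac, Finset.sum_range_succ']
  simp

/-- The Pascal rule for `Nat.multichoose`; it matches the recursion for products obtained by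
applying αβ = σ(α - β) once. -/
theorem pfrac_succ (σ α : ℂ) (p q : ℕ) :
    pfrac σ α (p + 1) (q + 1) = σ * (pfrac σ α p (q + 1) - pfrac σ α (p + 1) q) := by
  simp only [pfrac]
  rw [Finset.sum_range_succ', Finset.sum_range_succ' _ q, add_sub_right_comm,
    ← Finset.sum_sub_distrib, mul_add, Finset.mul_sum]
  congr 1
  · refine Finset.sum_congr rfl fun m _ => ?_
    rw [Nat.multichoose_succ_succ, show q + 1 - (m + 1) = q - m by omega]
    push_cast
    ring
  · simp
    ring

/-- Exchanging α and β changes the sign of σ, hence the second summand. Both sides obey the same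
recursion in p and q; the case p = q = 0 is excluded because there the left side is 1 and the right
side 0. -/
theorem pow_mul_pow_eq_pfrac (σ α β : ℂ) (h : α * β = σ * (α - β)) (p q : ℕ) (hpq : 0 < p + q) :
    α ^ q * β ^ p = pfrac σ α p q + pfrac (-σ) β q p := by
  induction p generalizing q with
  | zero =>
    obtain ⟨q, rfl⟩ : ∃ r, q = r + 1 := ⟨q - 1, by omega⟩
    simp [pfrac_zero_right, pfrac_zero_left]
  | succ p ih =>
    induction q with
    | zero => simp [pfrac_zero_right, pfrac_zero_left]
    | succ q ih' =>
      have h1 := ih (q + 1) (by omega)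
      have h2 := ih' (by omega)
      rw [pfrac_succ, pfrac_succ]
      linear_combination α ^ q * β ^ p * h + σ * h1 - σ * h2

/-- At α = -σ all terms share one sign and one power of σ, so only the sum of the coefficients
remains. -/
theorem pfrac_neg_self (σ : ℂ) (p q : ℕ) (hq : 1 ≤ q) :
    pfrac σ (-σ) p q = (-1) ^ q * ((p + q - 1).choose p : ℂ) * σ ^ (p + q) := by
  obtain ⟨q, rfl⟩ : ∃ r, q = r + 1 := ⟨q - 1, by omega⟩
  rw [show p + (q + 1) - 1 = p + q by omega, ← sum_multichoose, pfrac]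
  push_cast
  rw [Finset.mul_sum, Finset.sum_mul]
  refine Finset.sum_congr rfl fun m hm => ?_
  obtain ⟨d, hd⟩ := Nat.exists_eq_add_of_le (Finset.mem_range.1 hm)
  rw [hd, show m.succ + d - m = d + 1 by omega, neg_pow]
  have : ((-1 : ℂ) ^ m) ^ 2 = 1 := by rw [← pow_mul, mul_comm, pow_mul]; simp
  rw [Nat.succ_eq_add_one]
  ring

theorem pfrac_zero_base (σ : ℂ) (p q : ℕ) : pfrac σ 0 p q = 0 := by
  refine Finset.sum_eq_zero fun m hm => ?_
  rw [zero_pow (by have := Finset.mem_range.1 hm; omega), mul_zero]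

/-! ### Convergence of the one-dimensional series -/

/-- Summation by parts in abstract form: f is a telescoping difference up to an error that is itself
dominated by a telescoping difference. -/
theorem norm_sum_Ico_le_of_telescope {f g : ℕ → ℂ} {v : ℕ → ℝ} {D : ℝ}
    (hg : ∀ k, ‖g k‖ ≤ D / v k)
    (hf : ∀ k, ‖f k - (g k - g (k + 1))‖ ≤ D * (1 / v k - 1 / v (k + 1)))
    {n m : ℕ} (hnm : n ≤ m) : ‖∑ k ∈ Finset.Ico n m, f k‖ ≤ 2 * D / v n := by
  have key : ‖∑ k ∈ Finset.Ico n m, f k - (g n - g m)‖ ≤ D * (1 / v n - 1 / v m) := by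
    induction m, hnm using Nat.le_induction with
    | base => simp
    | succ m hm ih =>
      rw [Finset.sum_Ico_succ_top hm]
      calc _ = ‖(∑ k ∈ Finset.Ico n m, f k - (g n - g m)) + (f m - (g m - g (m + 1)))‖ := by
            congr 1; ring
        _ ≤ _ := (norm_add_le _ _).trans (add_le_add ih (hf m))
        _ = _ := by ring
  have h1 : ‖∑ k ∈ Finset.Ico n m, f k‖
      ≤ ‖∑ k ∈ Finset.Ico n m, f k - (g n - g m)‖ + (‖g n‖ + ‖g m‖) := by
    calc _ = ‖(∑ k ∈ Finset.Ico n m, f k - (g n - g m)) + (g n - g m)‖ := by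
          congr 1; ring
      _ ≤ _ := (norm_add_le _ _).trans (by gcongr; exact norm_sub_le _ _)
  have h2 := hg n
  have h3 := hg m
  have h4 : D * (1 / v n - 1 / v m) = D / v n - D / v m := by ring
  have h5 : 2 * D / v n = D / v n + D / v n := by ring
  linarith

theorem exists_norm_sum_Ico_le {z : ℂ} (hz : ‖z‖ = 1) {p : ℕ} (hp : 1 ≤ p)
    (hpz : (p, z) ≠ (1, 1)) {α : ℝ} (hα : 1 / 2 ≤ α) :
    ∃ C : ℝ, ∀ n m : ℕ, n ≤ m →
      ‖∑ k ∈ Finset.Ico n m, z ^ k / ((k : ℂ) + α) ^ p‖ ≤ C / ((n : ℝ) + α) := by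
  have hpos : ∀ k : ℕ, (0 : ℝ) < k + α := fun k => by positivity
  have hcast : ∀ k : ℕ, ((k : ℂ) + α) = ((k + α : ℝ) : ℂ) := fun k => by push_cast; rfl
  have hnorm : ∀ k : ℕ, ‖((k : ℂ) + α)‖ = k + α := fun k => by
    rw [hcast, Complex.norm_real, Real.norm_of_nonneg (hpos k).le]
  have hne : ∀ k : ℕ, ((k : ℂ) + α) ≠ 0 := fun k => by
    rw [← norm_pos_iff, hnorm]; exact hpos k
  have hsub : ∀ k : ℕ, (1 / ((k : ℝ) + α) - 1 / (((k + 1 : ℕ) : ℝ) + α))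
      = 1 / ((k + α) * (k + α + 1)) := fun k => by
    have := hpos k
    have := hpos (k + 1)
    push_cast at this ⊢
    field_simp
    ring
  rcases hp.eq_or_lt with rfl | hp2
  · have hz1 : z ≠ 1 := fun h => hpz (by rw [h])
    have hz1' : 1 - z ≠ 0 := sub_ne_zero.2 hz1.symm
    -- Here g is the Abel summation primitive: the geometric factor is summed, and the remainder is
    -- of second order.
    refine ⟨2 * (1 / ‖1 - z‖), fun n m hnm => norm_sum_Ico_le_of_telescope
      (g := fun k => z ^ k / ((k : ℂ) + α) / (1 - z)) (v := fun k => (k : ℝ) + α)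
      (fun k => ?_) (fun k => ?_) hnm⟩
    · rw [norm_div, norm_div, norm_pow, hz, hnorm, one_pow, div_right_comm]
    · have h1 := hne k
      have h2 := hne (k + 1)
      have : z ^ k / ((k : ℂ) + α) ^ 1 - (z ^ k / ((k : ℂ) + α) / (1 - z)
          - z ^ (k + 1) / (((k + 1 : ℕ) : ℂ) + α) / (1 - z))
          = -(z ^ (k + 1) / ((k + α) * ((k + 1 : ℕ) + α)) / (1 - z)) := by
        field_simp
        push_cast
        ring
      rw [this, hsub, norm_neg, norm_div, norm_div, norm_mul, norm_pow, hz, hnorm, hnorm,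
        one_pow]
      push_cast
      apply le_of_eq
      ring
  -- No cancellation is needed. With v = k + α ≥ 1/2 one has v + 1 ≤ 3v and 1 ≤ (2v)^(p-2), whence
  -- the constant.
  · refine ⟨2 * (3 * 2 ^ (p - 2)), fun n m hnm => norm_sum_Ico_le_of_telescope
      (g := fun k => 0) (v := fun k => (k : ℝ) + α)
      (fun k => ?_) (fun k => ?_) hnm⟩
    · have := hpos k
      rw [norm_zero]; positivity
    · have hk := hpos k
      have hk2 : (1 : ℝ) / 2 ≤ k + α := by linarith [Nat.cast_nonneg (α := ℝ) k]
      rw [hsub, sub_zero, sub_zero, norm_div, norm_pow, norm_pow, hz, hnorm, one_pow]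
      obtain ⟨r, rfl⟩ : ∃ r, p = r + 2 := ⟨p - 2, by omega⟩
      set v : ℝ := k + α
      have h1 : 1 ≤ 2 ^ r * v ^ r := by
        rw [← mul_pow]; exact one_le_pow₀ (by linarith)
      rw [show r + 2 - 2 = r by omega, mul_one_div, div_le_div_iff₀ (by positivity) (by positivity)]
      calc 1 * (v * (v + 1)) ≤ 1 * (v * (3 * v)) := by gcongr; linarith
        _ ≤ (2 ^ r * v ^ r) * (v * (3 * v)) := by gcongr
        _ = _ := by ring

theorem tendsto_of_norm_sum_Ico_le {f : ℕ → ℂ} {C α : ℝ}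
    (h : ∀ n m : ℕ, n ≤ m → ‖∑ k ∈ Finset.Ico n m, f k‖ ≤ C / ((n : ℝ) + α)) :
    ∃ L : ℂ, Tendsto (fun n => ∑ k ∈ Finset.range n, f k) atTop (𝓝 L) ∧
      ∀ n : ℕ, ‖L - ∑ k ∈ Finset.range n, f k‖ ≤ C / ((n : ℝ) + α) := by
  have hlim : Tendsto (fun n : ℕ => C / ((n : ℝ) + α)) atTop (𝓝 0) :=
    tendsto_const_nhds.div_atTop (tendsto_atTop_add_const_right _ _ tendsto_natCast_atTop_atTop)
  have hc : CauchySeq fun n => ∑ k ∈ Finset.range n, f k := by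
    refine cauchySeq_of_le_tendsto_0' _ (fun n m hnm => ?_) hlim
    rw [dist_comm, dist_eq_norm, ← Finset.sum_Ico_eq_sub _ hnm]
    exact h n m hnm
  obtain ⟨L, hL⟩ := cauchySeq_tendsto_of_complete hc
  refine ⟨L, hL, fun n => ?_⟩
  refine le_of_tendsto (hL.sub_const _).norm ?_
  filter_upwards [eventually_ge_atTop n] with m hm
  rw [← Finset.sum_Ico_eq_sub _ hm]
  exact h n m hm

theorem zetaSum_eq (n p : ℕ) (x : ℂ) :
    zetaSum n p x = x * ∑ k ∈ Finset.range n, x ^ k / ((k : ℂ) + (1 : ℝ)) ^ p := by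
  induction n with
  | zero => simp [zetaSum]
  | succ n ih =>
    rw [Finset.sum_range_succ, mul_add, ← ih, zetaSum, zetaSum, Finset.sum_Icc_succ_top (by omega)]
    push_cast
    ring

theorem tSum_eq (n p : ℕ) (x : ℂ) :
    tSum n p x = x * ∑ k ∈ Finset.range n, x ^ k / ((k : ℂ) + (1 / 2 : ℝ)) ^ p := by
  induction n with
  | zero => simp [tSum]
  | succ n ih =>
    rw [Finset.sum_range_succ, mul_add, ← ih, tSum, tSum, Finset.sum_Icc_succ_top (by omega)]
    push_cast
    ring

theorem exists_norm_Li_sub_zetaSum_le {z : ℂ} (hz : ‖z‖ = 1) {p : ℕ} (hp : 1 ≤ p)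
    (hpz : (p, z) ≠ (1, 1)) :
    Tendsto (fun n => zetaSum n p z) atTop (𝓝 (Li p z)) ∧
      ∃ C : ℝ, ∀ n : ℕ, ‖Li p z - zetaSum n p z‖ ≤ C / ((n : ℝ) + 1) := by
  obtain ⟨C, hC⟩ := exists_norm_sum_Ico_le hz hp hpz (α := 1) (by norm_num)
  obtain ⟨L, hL, hb⟩ := tendsto_of_norm_sum_Ico_le hC
  have h : Tendsto (fun n => zetaSum n p z) atTop (𝓝 (z * L)) := by
    simp only [zetaSum_eq]
    exact hL.const_mul z
  have hLi : Li p z = z * L := h.limUnder_eq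
  refine ⟨hLi ▸ h, C, fun n => ?_⟩
  rw [hLi, zetaSum_eq, ← mul_sub, norm_mul, hz, one_mul]
  exact hb n

theorem tendsto_zetaSum {z : ℂ} (hz : ‖z‖ = 1) {p : ℕ} (hp : 1 ≤ p) (hpz : (p, z) ≠ (1, 1)) :
    Tendsto (fun n => zetaSum n p z) atTop (𝓝 (Li p z)) :=
  (exists_norm_Li_sub_zetaSum_le hz hp hpz).1

theorem tendsto_tSum {z : ℂ} (hz : ‖z‖ = 1) {p : ℕ} (hp : 1 ≤ p) (hpz : (p, z) ≠ (1, 1)) :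
    Tendsto (fun n => tSum n p z) atTop (𝓝 (ti p z)) := by
  obtain ⟨C, hC⟩ := exists_norm_sum_Ico_le hz hp hpz (α := 1 / 2) (by norm_num)
  obtain ⟨L, hL, -⟩ := tendsto_of_norm_sum_Ico_le hC
  have h : Tendsto (fun n => tSum n p z) atTop (𝓝 (z * L)) := by
    simp only [tSum_eq]
    exact hL.const_mul z
  have hti : ti p z = z * L := h.limUnder_eq
  exact hti ▸ h

theorem tendsto_sum_range_ti {z : ℂ} (hz : ‖z‖ = 1) {p : ℕ} (hp : 1 ≤ p)
    (hpz : (p, z) ≠ (1, 1)) :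
    Tendsto (fun n : ℕ => ∑ k ∈ Finset.range n, z ^ k / ((k : ℂ) + 1 / 2) ^ p) atTop
      (𝓝 (z⁻¹ * ti p z)) := by
  have h0 : z ≠ 0 := norm_ne_zero_iff.1 (by rw [hz]; exact one_ne_zero)
  refine ((tendsto_tSum hz hp hpz).const_mul z⁻¹).congr fun n => ?_
  rw [tSum_eq, inv_mul_cancel_left₀ h0]
  push_cast
  rfl

/-- `R`-sums converge. -/
theorem tendsto_RSum {y z : ℂ} (hy : ‖y‖ = 1) (hz : ‖z‖ = 1) {p q : ℕ} (hp : 1 ≤ p)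
    (hq : 1 ≤ q) (hpy : (p, y) ≠ (1, 1)) (hqz : (q, z) ≠ (1, 1)) :
    Tendsto (fun N => RSum N p q y z) atTop (𝓝 (R p q y z)) := by
  suffices h : ∃ L, Tendsto (fun N => RSum N p q y z) atTop (𝓝 L) by
    obtain ⟨L, hL⟩ := h
    have : R p q y z = L := hL.limUnder_eq
    exact this ▸ hL
  -- Replacing ζ_n by its limit leaves a `ti` series; the correction has terms O(1/n²) and converges
  -- absolutely.
  obtain ⟨-, C, hC⟩ := exists_norm_Li_sub_zetaSum_le hy hp hpy
  have hsum : Summable fun n : ℕ =>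
      (Li p y - zetaSum n p y) * (z ^ n / ((n : ℂ) + 1 / 2) ^ q) := by
    have hs : Summable fun n : ℕ => (C * 2 ^ q) * (1 / ((n + 1 : ℕ) : ℝ) ^ 2) :=
      ((summable_nat_add_iff 1).2 (Real.summable_one_div_nat_pow.2 one_lt_two)).mul_left _
    refine hs.of_norm_bounded fun n => ?_
    have hC0 : 0 ≤ C := by simpa using (norm_nonneg _).trans (hC 0)
    have hn : ‖((n : ℂ) + 1 / 2)‖ = (n : ℝ) + 1 / 2 := by
      rw [show ((n : ℂ) + 1 / 2) = ((n + 1 / 2 : ℝ) : ℂ) by push_cast; rfl, Complex.norm_real,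
        Real.norm_of_nonneg (by positivity)]
    have h1 : ((n : ℝ) + 1) ≤ 2 ^ q * ((n : ℝ) + 1 / 2) ^ q := by
      rw [← mul_pow]
      have h0 : (0 : ℝ) ≤ n := Nat.cast_nonneg n
      exact (by linarith : (n : ℝ) + 1 ≤ 2 * ((n : ℝ) + 1 / 2)).trans
        (le_self_pow₀ (by linarith) (by omega))
    rw [norm_mul, norm_div, norm_pow, norm_pow, hz, one_pow, hn]
    calc _ ≤ C / ((n : ℝ) + 1) * (1 / ((n : ℝ) + 1 / 2) ^ q) := by gcongr; exact hC n
      _ = C / ((n : ℝ) + 1) * (2 ^ q / (2 ^ q * ((n : ℝ) + 1 / 2) ^ q)) := by field_simp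
      _ ≤ C / ((n : ℝ) + 1) * (2 ^ q / ((n : ℝ) + 1)) := by gcongr
      _ = _ := by push_cast; field_simp
  have h1 := hsum.hasSum.tendsto_sum_nat
  have h2 := (tendsto_sum_range_ti hz hq hqz).const_mul (Li p y)
  refine ⟨_, (h2.sub h1).congr fun N => ?_⟩
  rw [Finset.mul_sum, ← Finset.sum_sub_distrib, RSum]
  refine Finset.sum_congr rfl fun n _ => ?_
  ring

/-! ### Symmetric bilateral sums -/

/-- The symmetric partial sum `∑_{n=-N}^{N-1} f n`. -/
noncomputable def symSum (f : ℤ → ℂ) (N : ℕ) : ℂ :=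
  ∑ n ∈ Finset.range N, (f n + f (-((n : ℤ) + 1)))

theorem symSum_succ (f : ℤ → ℂ) (N : ℕ) :
    symSum f (N + 1) = symSum f N + (f N + f (-((N : ℤ) + 1))) :=
  Finset.sum_range_succ _ _

theorem pair_inv_ne_one {b : ℕ} {w : ℂ} (h : (b, w) ≠ (1, 1)) : (b, w⁻¹) ≠ (1, 1) := by
  simpa using h

theorem symSum_sum {ι : Type*} (s : Finset ι) (f : ι → ℤ → ℂ) (N : ℕ) :
    symSum (fun n => ∑ i ∈ s, f i n) N = ∑ i ∈ s, symSum (f i) N := by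
  simp only [symSum]
  rw [Finset.sum_comm]
  simp only [Finset.sum_add_distrib]

theorem symSum_mul_left (c : ℂ) (f : ℤ → ℂ) (N : ℕ) :
    symSum (fun n => c * f n) N = c * symSum f N := by
  simp only [symSum, Finset.mul_sum, mul_add]

theorem symSum_add (f g : ℤ → ℂ) (N : ℕ) :
    symSum (fun n => f n + g n) N = symSum f N + symSum g N := by
  simp only [symSum, ← Finset.sum_add_distrib]
  exact Finset.sum_congr rfl fun n _ => by ring

theorem symSum_sub (f g : ℤ → ℂ) (N : ℕ) :
    symSum (fun n => f n - g n) N = symSum f N - symSum g N := by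
  simp only [symSum, ← Finset.sum_sub_distrib]
  exact Finset.sum_congr rfl fun n _ => by ring

theorem symSum_shift (f : ℤ → ℂ) (N : ℕ) :
    symSum (fun n => f (n + 1)) N = symSum f N + f N - f (-N) := by
  induction N with
  | zero => simp [symSum]
  | succ N ih =>
    rw [symSum_succ, ih, symSum_succ]
    push_cast
    rw [show -((N : ℤ) + 1) + 1 = -N by ring]
    ring

theorem tendsto_symSum_shift {f : ℤ → ℂ} {L : ℂ} (hf : Tendsto f cofinite (𝓝 0))
    (h : Tendsto (symSum f) atTop (𝓝 L)) (i : ℕ) :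
    Tendsto (symSum fun n => f (n + i)) atTop (𝓝 L) := by
  induction i with
  | zero => simpa using h
  | succ i ih =>
    have hi : Tendsto (fun n : ℤ => f (n + i)) cofinite (𝓝 0) :=
      hf.comp (add_left_injective (i : ℤ)).tendsto_cofinite
    have h1 : Tendsto (fun N : ℕ => f ((N : ℤ) + i)) atTop (𝓝 0) := by
      rw [← Nat.cofinite_eq_atTop]
      exact hi.comp (Nat.cast_injective (R := ℤ)).tendsto_cofinite
    have h2 : Tendsto (fun N : ℕ => f (-(N : ℤ) + i)) atTop (𝓝 0) := by
      rw [← Nat.cofinite_eq_atTop]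
      exact hi.comp (neg_injective.comp (Nat.cast_injective (R := ℤ))).tendsto_cofinite
    have h3 := (ih.add h1).sub h2
    rw [add_zero, sub_zero] at h3
    refine h3.congr fun N => ?_
    rw [← symSum_shift fun n => f (n + i)]
    refine congrArg (fun g => symSum g N) (funext fun n => ?_)
    push_cast
    congr 1
    ring

theorem tendsto_zpow_mul_inv_pow_cofinite {x : ℂ} (hx : ‖x‖ = 1) {b : ℕ} (hb : 1 ≤ b) :
    Tendsto (fun k : ℤ => x ^ (-k) * ((k : ℂ)⁻¹) ^ b) cofinite (𝓝 0) := by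
  have h1 : Tendsto (fun k : ℤ => ‖(k : ℝ)‖) cofinite atTop :=
    (tendsto_norm_cocompact_atTop).comp Int.tendsto_coe_cofinite
  have h2 := (h1.inv_tendsto_atTop).pow b
  rw [zero_pow (by omega)] at h2
  refine squeeze_zero_norm (fun k => le_of_eq ?_) h2
  simp [norm_zpow, hx]

theorem tendsto_symSum_half {x : ℂ} (hx : ‖x‖ = 1) {b : ℕ} (hb : 1 ≤ b) :
    Tendsto (symSum fun n => x ^ (-(n + 1)) * (((n : ℂ) + 1 / 2)⁻¹) ^ b) atTop
      (𝓝 (ti b x⁻¹ + (-1) ^ b * x⁻¹ * ti b x)) := by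
  have h0 : x ≠ 0 := norm_ne_zero_iff.1 (by rw [hx]; exact one_ne_zero)
  have key : ∀ N : ℕ, symSum (fun n => x ^ (-(n + 1)) * (((n : ℂ) + 1 / 2)⁻¹) ^ b) N
      = tSum N b x⁻¹ + (-1) ^ b * x⁻¹ * tSum N b x := fun N => by
    induction N with
    | zero => simp [symSum, tSum]
    | succ N ih =>
      rw [symSum_succ, ih, tSum, tSum, tSum, tSum,
        Finset.sum_Icc_succ_top (by omega), Finset.sum_Icc_succ_top (by omega)]
      have e1 : x ^ (-((N : ℤ) + 1)) = x⁻¹ ^ (N + 1) := by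
        rw [zpow_neg, inv_pow]; norm_cast
      have e2 : x ^ (-(-((N : ℤ) + 1) + 1)) = x ^ N := by
        rw [show -(-((N : ℤ) + 1) + 1) = N by ring, zpow_natCast]
      have e3 : (((-((N : ℤ) + 1) : ℤ) : ℂ) + 1 / 2)⁻¹ = -((N : ℂ) + 1 / 2)⁻¹ := by
        rw [← inv_neg]; push_cast; congr 1; ring
      have e4 : (((N + 1 : ℕ) : ℂ) - 1 / 2) = (N : ℂ) + 1 / 2 := by push_cast; ring
      rw [e1, e2, e3, e4, neg_pow (_⁻¹), pow_succ x N, Int.cast_natCast,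
        inv_pow ((N : ℂ) + 1 / 2)]
      generalize ((N : ℂ) + 1 / 2) ^ b = v
      linear_combination (-((-1) ^ b * x ^ N * v⁻¹)) * inv_mul_cancel₀ h0
  -- In the divergent case the unspecified value `ti 1 1` is subtracted from itself, and the
  -- symmetric partial sums vanish identically.
  by_cases h : (b, x) = (1, 1)
  · obtain ⟨rfl, rfl⟩ := Prod.mk.inj h
    simp only [funext key]
    simp
  · have h' := pair_inv_ne_one h
    exact ((tendsto_tSum (by rw [norm_inv, hx, inv_one]) hb h').add
      ((tendsto_tSum hx hb h).const_mul _)).congr fun N => (key N).symm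

theorem tendsto_symSum_int {x : ℂ} (hx : ‖x‖ = 1) {b : ℕ} (hb : 1 ≤ b) :
    Tendsto (symSum fun k => x ^ (-k) * ((k : ℂ)⁻¹) ^ b) atTop
      (𝓝 (Li b x⁻¹ + (-1) ^ b * Li b x)) := by
  -- The window from -N to N-1 misses k = N, and k = 0 contributes 0 since `0⁻¹ = 0` and b ≥ 1.
  have key : ∀ N : ℕ, symSum (fun k => x ^ (-k) * ((k : ℂ)⁻¹) ^ b) N
      = zetaSum N b x⁻¹ + (-1) ^ b * zetaSum N b x - x ^ (-(N : ℤ)) * (((N : ℤ) : ℂ)⁻¹) ^ b :=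
    fun N => by
    induction N with
    | zero => simp [symSum, zetaSum, zero_pow (show b ≠ 0 by omega)]
    | succ N ih =>
      rw [symSum_succ, ih, zetaSum, zetaSum, zetaSum, zetaSum,
        Finset.sum_Icc_succ_top (by omega), Finset.sum_Icc_succ_top (by omega)]
      have e1 : x⁻¹ ^ (N + 1) = x ^ (-((N : ℤ) + 1)) := by
        rw [zpow_neg, inv_pow]; norm_cast
      have e2 : x ^ (-(-((N : ℤ) + 1))) = x ^ (N + 1) := by
        rw [neg_neg]; norm_cast
      have e3 : (((-((N : ℤ) + 1) : ℤ) : ℂ))⁻¹ = -((N : ℂ) + 1)⁻¹ := by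
        rw [← inv_neg]; push_cast; rfl
      rw [e1, e2, e3, neg_pow (_⁻¹)]
      push_cast
      rw [inv_pow, inv_pow]
      ring
  have hN : Tendsto (fun N : ℕ => x ^ (-(N : ℤ)) * (((N : ℤ) : ℂ)⁻¹) ^ b) atTop (𝓝 0) := by
    rw [← Nat.cofinite_eq_atTop]
    exact (tendsto_zpow_mul_inv_pow_cofinite hx hb).comp
      (Nat.cast_injective (R := ℤ)).tendsto_cofinite
  suffices h : Tendsto (fun N => zetaSum N b x⁻¹ + (-1) ^ b * zetaSum N b x) atTop
      (𝓝 (Li b x⁻¹ + (-1) ^ b * Li b x)) by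
    have := h.sub hN
    rw [sub_zero] at this
    exact this.congr fun N => (key N).symm
  by_cases h : (b, x) = (1, 1)
  · obtain ⟨rfl, rfl⟩ := Prod.mk.inj h
    simp
  · have h' := pair_inv_ne_one h
    exact (tendsto_zetaSum (by rw [norm_inv, hx, inv_one]) hb h').add
      ((tendsto_zetaSum hx hb h).const_mul _)

theorem tendsto_symSum_int_shift {x : ℂ} (hx : ‖x‖ = 1) {b : ℕ} (hb : 1 ≤ b) (i : ℕ) :
    Tendsto (symSum fun n => x ^ (-(n + 1)) * (((n + 1 + i : ℤ) : ℂ)⁻¹) ^ b) atTop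
      (𝓝 (x ^ i * (Li b x⁻¹ + (-1) ^ b * Li b x))) := by
  have h0 : x ≠ 0 := norm_ne_zero_iff.1 (by rw [hx]; exact one_ne_zero)
  have h := tendsto_symSum_shift (tendsto_zpow_mul_inv_pow_cofinite hx hb)
    (tendsto_symSum_int hx hb) (i + 1)
  refine (h.const_mul (x ^ i)).congr fun N => ?_
  rw [← symSum_mul_left]
  refine congrArg (fun g => symSum g N) (funext fun n => ?_)
  rw [← mul_assoc, ← zpow_natCast x i, ← zpow_add₀ h0]
  push_cast
  congr 2
  · ring
  · ring_nf

/-! ### The inner sum for a fixed difference of the summation indices -/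

theorem tendsto_symSum_pfrac {w α : ℤ → ℂ} {τ : ℕ → ℂ}
    (h : ∀ b, 1 ≤ b → Tendsto (symSum fun n => w n * α n ^ b) atTop (𝓝 (τ b))) (s : ℂ) (p q : ℕ) :
    Tendsto (symSum fun n => w n * pfrac s (α n) p q) atTop
      (𝓝 (∑ m ∈ Finset.range q,
        (-1) ^ m * (Nat.multichoose p m : ℂ) * s ^ (p + m) * τ (q - m))) := by
  have h1 : Tendsto (fun N => ∑ m ∈ Finset.range q,
      (-1) ^ m * (Nat.multichoose p m : ℂ) * s ^ (p + m) * symSum (fun n => w n * α n ^ (q - m)) N)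
      atTop (𝓝 (∑ m ∈ Finset.range q,
        (-1) ^ m * (Nat.multichoose p m : ℂ) * s ^ (p + m) * τ (q - m))) :=
    tendsto_finsetSum _ fun m hm => (h (q - m) (by
      have := Finset.mem_range.1 hm; omega)).const_mul _
  refine h1.congr fun N => ?_
  simp only [← symSum_mul_left, ← symSum_sum]
  refine congrArg (fun g => symSum g N) (funext fun n => ?_)
  rw [pfrac, Finset.mul_sum]
  exact Finset.sum_congr rfl fun m _ => by ring

theorem tendsto_symSum_single (g : ℂ) (x : ℂ) (i : ℕ) :
    Tendsto (symSum fun n => x ^ (-(n + 1)) * (if n + 1 + i = 0 then g else 0)) atTop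
      (𝓝 (x ^ i * g)) := by
  refine tendsto_const_nhds.congr' ?_
  filter_upwards [eventually_gt_atTop i] with N hN
  rw [symSum, Finset.sum_eq_single i]
  · rw [if_neg (by omega), if_pos (by omega), mul_zero, zero_add,
      show -(-((i : ℤ) + 1) + 1) = i by ring, zpow_natCast]
  · intro n _ hn
    rw [if_neg (by omega), if_neg (by omega)]
    simp
  · intro h
    exact absurd (Finset.mem_range.2 hN) h

theorem half_ne_zero (n : ℤ) : ((n : ℂ) + 1 / 2) ≠ 0 := by
  intro h
  have h1 : ((2 * n + 1 : ℤ) : ℂ) = 0 := by push_cast; linear_combination 2 * h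
  have h2 : 2 * n + 1 = 0 := by exact_mod_cast h1
  omega

/-- For n + 1 + i = 0 the convention `0⁻¹ = 0` kills the left side, but the expansion in powers of
(n+1/2)⁻¹ = -(i+1/2)⁻¹ survives; the last term removes it. -/
theorem half_pow_mul_int_pow_eq (n : ℤ) (i : ℕ) {p q : ℕ} (hp : 1 ≤ p) (hq : 1 ≤ q) :
    (((n : ℂ) + 1 / 2)⁻¹) ^ q * (((n + 1 + i : ℤ) : ℂ)⁻¹) ^ p
      = pfrac ((i : ℂ) + 1 / 2)⁻¹ ((n : ℂ) + 1 / 2)⁻¹ p q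
        + pfrac (-((i : ℂ) + 1 / 2)⁻¹) ((n + 1 + i : ℤ) : ℂ)⁻¹ q p
        - (if n + 1 + i = 0 then
            (-1) ^ q * ((p + q - 1).choose p : ℂ) * (((i : ℂ) + 1 / 2)⁻¹) ^ (p + q) else 0) := by
  have hi := half_ne_zero i
  have hn := half_ne_zero n
  rw [Int.cast_natCast] at hi
  split_ifs with h
  · have e : ((n : ℂ) + 1 / 2)⁻¹ = -((i : ℂ) + 1 / 2)⁻¹ := by
      have : (n : ℂ) = -1 - i := by
        have : n = -1 - i := by omega
        rw [this]; push_cast; ring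
      rw [← inv_neg, this]
      congr 1
      ring
    rw [h, Int.cast_zero, inv_zero, zero_pow (by omega), pfrac_zero_base, e, pfrac_neg_self _ _ _ hq]
    ring
  · rw [sub_zero]
    refine pow_mul_pow_eq_pfrac _ _ _ ?_ p q (by omega)
    have hk : ((n + 1 + i : ℤ) : ℂ) ≠ 0 := by exact_mod_cast h
    have hs : ((n + 1 + i : ℤ) : ℂ) - (n + 1 / 2) = i + 1 / 2 := by push_cast; ring
    generalize ((n + 1 + i : ℤ) : ℂ) = k at *
    generalize (n : ℂ) + 1 / 2 = h at *
    rw [← hs] at hi ⊢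
    field_simp

theorem tendsto_symSum_inner {x y : ℂ} (hx : ‖x‖ = 1) (hy : ‖y‖ = 1) {p q : ℕ} (hp : 1 ≤ p)
    (hq : 1 ≤ q) (i : ℕ) :
    Tendsto (symSum fun n => (x * y) ^ (-(n + 1)) * (((n : ℂ) + 1 / 2)⁻¹) ^ q
        * (y ^ (n + 1 + i) * (((n + 1 + i : ℤ) : ℂ)⁻¹) ^ p)) atTop
      (𝓝 (y ^ i * ∑ m ∈ Finset.range q, (-1) ^ m * (Nat.multichoose p m : ℂ)
            * (((i : ℂ) + 1 / 2)⁻¹) ^ (p + m)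
            * (ti (q - m) x⁻¹ + (-1) ^ (q - m) * x⁻¹ * ti (q - m) x)
        + (x * y) ^ i * ∑ m ∈ Finset.range p, (-1) ^ m * (Nat.multichoose q m : ℂ)
            * (-((i : ℂ) + 1 / 2)⁻¹) ^ (q + m)
            * (Li (p - m) x⁻¹ + (-1) ^ (p - m) * Li (p - m) x)
        - (x * y) ^ i * ((-1) ^ q * ((p + q - 1).choose p : ℂ)
            * (((i : ℂ) + 1 / 2)⁻¹) ^ (p + q)))) := by
  have hy0 : y ≠ 0 := norm_ne_zero_iff.1 (by rw [hy]; exact one_ne_zero)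
  have h1 := tendsto_symSum_pfrac (w := fun n => x ^ (-(n + 1)))
    (α := fun n => ((n : ℂ) + 1 / 2)⁻¹) (fun b hb => tendsto_symSum_half hx hb)
    ((i : ℂ) + 1 / 2)⁻¹ p q
  have h2 := tendsto_symSum_pfrac (w := fun n => x ^ (-(n + 1)))
    (α := fun n => ((n + 1 + i : ℤ) : ℂ)⁻¹) (fun b hb => tendsto_symSum_int_shift hx hb i)
    (-((i : ℂ) + 1 / 2)⁻¹) q p
  have h3 := tendsto_symSum_single ((-1) ^ q * ((p + q - 1).choose p : ℂ)
            * (((i : ℂ) + 1 / 2)⁻¹) ^ (p + q)) x i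
  have h := ((h1.add h2).sub h3).const_mul (y ^ i)
  convert h.congr fun N => ?_ using 2
  · rw [mul_sub, mul_add, mul_pow, mul_comm (x ^ i), mul_assoc (y ^ i), mul_assoc (y ^ i),
      Finset.mul_sum (a := x ^ i)]
    congr 3
    exact Finset.sum_congr rfl fun m _ => by ring
  · rw [← symSum_add, ← symSum_sub, ← symSum_mul_left]
    refine congrArg (fun g => symSum g N) (funext fun n => ?_)
    rw [← mul_add, ← mul_sub, ← half_pow_mul_int_pow_eq n i hp hq, mul_zpow, zpow_add₀ hy0 (n + 1),
      zpow_natCast, zpow_neg y]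
    have := zpow_ne_zero (n + 1) hy0
    field_simp

/-- The sum over all differences of the indices of the inner sums. -/
theorem tendsto_sum_range_pfrac {z : ℂ} (hz : ‖z‖ = 1) {p : ℕ} (hp : 1 ≤ p) (hpz : (p, z) ≠ (1, 1))
    (ε : ℂ) (τ : ℕ → ℂ) (q : ℕ) :
    Tendsto (fun M : ℕ => ∑ i ∈ Finset.range M, z ^ i * ∑ m ∈ Finset.range q,
        (-1) ^ m * (Nat.multichoose p m : ℂ) * (ε * ((i : ℂ) + 1 / 2)⁻¹) ^ (p + m) * τ m) atTop
      (𝓝 (∑ m ∈ Finset.range q,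
        (-1) ^ m * (Nat.multichoose p m : ℂ) * ε ^ (p + m) * (z⁻¹ * ti (p + m) z) * τ m)) := by
  have h : Tendsto (fun M : ℕ => ∑ m ∈ Finset.range q, (-1) ^ m * (Nat.multichoose p m : ℂ)
      * ε ^ (p + m) * (∑ i ∈ Finset.range M, z ^ i / ((i : ℂ) + 1 / 2) ^ (p + m)) * τ m) atTop
      (𝓝 (∑ m ∈ Finset.range q,
        (-1) ^ m * (Nat.multichoose p m : ℂ) * ε ^ (p + m) * (z⁻¹ * ti (p + m) z) * τ m)) :=
    tendsto_finsetSum _ fun m _ => ((tendsto_sum_range_ti hz (by omega) (fun e => hpz (by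
      obtain ⟨e1, rfl⟩ := Prod.mk.inj e
      rw [show p = 1 by omega]))).const_mul _).mul_const _
  refine h.congr fun M => ?_
  simp only [Finset.mul_sum, Finset.sum_mul]
  rw [Finset.sum_comm]
  refine Finset.sum_congr rfl fun i _ => Finset.sum_congr rfl fun m _ => ?_
  rw [mul_pow, inv_pow, div_eq_mul_inv]
  ring

/-! ### Bilateral tails and the interchange of limits -/

/-- The tail `∑_{k > n, k ≠ 0} y ^ k / k ^ p` for an integer `n`. -/
noncomputable def tail (p : ℕ) (y : ℂ) : ℤ → ℂ
  | Int.ofNat n => Li p y - zetaSum n p y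
  | Int.negSucc n => Li p y + (-1) ^ p * zetaSum n p y⁻¹

theorem tail_natCast (p : ℕ) (y : ℂ) (n : ℕ) : tail p y n = Li p y - zetaSum n p y := rfl

theorem tail_neg (p : ℕ) (y : ℂ) (n : ℕ) :
    tail p y (-((n : ℤ) + 1)) = Li p y + (-1) ^ p * zetaSum n p y⁻¹ := by
  rw [← Int.negSucc_eq]; rfl

theorem zetaSum_succ (n p : ℕ) (x : ℂ) :
    zetaSum (n + 1) p x = zetaSum n p x + x ^ (n + 1) / ((n : ℂ) + 1) ^ p := by
  rw [zetaSum, Finset.sum_Icc_succ_top (by omega), ← zetaSum]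
  push_cast
  rfl

theorem tail_sub_tail_succ {p : ℕ} (hp : 1 ≤ p) (y : ℂ) (n : ℤ) :
    tail p y n - tail p y (n + 1) = y ^ (n + 1) * (((n + 1 : ℤ) : ℂ)⁻¹) ^ p := by
  obtain ⟨n, rfl⟩ | ⟨n, rfl⟩ : (∃ m : ℕ, n = m) ∨ ∃ m : ℕ, n = -((m : ℤ) + 1) := by
    rcases le_or_gt 0 n with h | h
    · exact Or.inl ⟨n.toNat, by omega⟩
    · exact Or.inr ⟨(-n - 1).toNat, by omega⟩
  · rw [← Nat.cast_succ, tail_natCast, tail_natCast, Nat.succ_eq_add_one, zetaSum_succ,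
      zpow_natCast, inv_pow]
    push_cast
    ring
  · cases n with
    -- The passage from n = -1 to n = 0 crosses the excluded index k = 0, so the tail does not
    -- change.
    | zero =>
      rw [tail_neg]
      have : -(((0 : ℕ) : ℤ) + 1) + 1 = ((0 : ℕ) : ℤ) := by simp
      rw [this, tail_natCast]
      simp [zetaSum, zero_pow (show p ≠ 0 by omega)]
    | succ n =>
      have e : -(((n + 1 : ℕ) : ℤ) + 1) + 1 = -((n : ℤ) + 1) := by push_cast; ring
      rw [e, tail_neg, tail_neg, zetaSum_succ]
      have e1 : y⁻¹ ^ (n + 1) = y ^ (-((n : ℤ) + 1)) := by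
        rw [zpow_neg, inv_pow]; norm_cast
      have e3 : (((-((n : ℤ) + 1) : ℤ) : ℂ))⁻¹ = -((n : ℂ) + 1)⁻¹ := by
        rw [← inv_neg]; push_cast; rfl
      rw [e1, e3, neg_pow (_⁻¹), inv_pow]
      ring

theorem sum_range_tail {p : ℕ} (hp : 1 ≤ p) (y : ℂ) (n : ℤ) (M : ℕ) :
    ∑ i ∈ Finset.range M, y ^ (n + 1 + i) * (((n + 1 + i : ℤ) : ℂ)⁻¹) ^ p
      = tail p y n - tail p y (n + M) := by
  induction M with
  | zero => simp
  | succ M ih =>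
    have := tail_sub_tail_succ hp y (n + M)
    rw [Finset.sum_range_succ, ih, show n + 1 + (M : ℤ) = n + M + 1 by ring, ← this]
    push_cast
    rw [add_assoc]
    ring

/-- The tail tends to 0 at +∞ and to the full bilateral sum at -∞, in both cases at the rate of the
one-sided remainders. -/
theorem exists_norm_tail_sub_le {p : ℕ} (hp : 1 ≤ p) {y : ℂ} (hy : ‖y‖ = 1)
    (hpy : (p, y) ≠ (1, 1)) :
    ∃ C : ℝ, 0 ≤ C ∧ ∀ n : ℤ, ‖tail p y n - if n < 0 then Li p y + (-1) ^ p * Li p y⁻¹ else 0‖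
      ≤ C / |(n : ℝ) + 1 / 2| := by
  have h' := pair_inv_ne_one hpy
  obtain ⟨-, C, hC⟩ := exists_norm_Li_sub_zetaSum_le hy hp hpy
  obtain ⟨-, D, hD⟩ := exists_norm_Li_sub_zetaSum_le (by rw [norm_inv, hy, inv_one]) hp h'
  have hC0 : 0 ≤ C := by simpa using (norm_nonneg _).trans (hC 0)
  have hD0 : 0 ≤ D := by simpa using (norm_nonneg _).trans (hD 0)
  refine ⟨C + D, by positivity, fun n => ?_⟩
  obtain ⟨n, rfl⟩ | ⟨n, rfl⟩ : (∃ m : ℕ, n = m) ∨ ∃ m : ℕ, n = -((m : ℤ) + 1) := by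
    rcases le_or_gt 0 n with h | h
    · exact Or.inl ⟨n.toNat, by omega⟩
    · exact Or.inr ⟨(-n - 1).toNat, by omega⟩
  · rw [if_neg (by omega), sub_zero, tail_natCast, Int.cast_natCast,
      abs_of_nonneg (show (0 : ℝ) ≤ (n : ℝ) + 1 / 2 by positivity)]
    refine (hC n).trans ?_
    gcongr
    · linarith
    · norm_num
  · rw [if_pos (by omega), tail_neg]
    have e : |((-((n : ℤ) + 1) : ℤ) : ℝ) + 1 / 2| = (n : ℝ) + 1 / 2 := by
      rw [← abs_neg]; push_cast
      rw [show -(-((n : ℝ) + 1) + 1 / 2) = n + 1 / 2 by ring, abs_of_nonneg (by positivity)]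
    have e2 : Li p y + (-1) ^ p * zetaSum n p y⁻¹ - (Li p y + (-1) ^ p * Li p y⁻¹)
        = -((-1) ^ p * (Li p y⁻¹ - zetaSum n p y⁻¹)) := by ring
    rw [e, e2, norm_neg, norm_mul, norm_pow, norm_neg, norm_one, one_pow, one_mul]
    refine (hD n).trans ?_
    gcongr
    · linarith
    · norm_num

/-- The larger of a and b is at least M/2. Half a power of it gives decay in M, and the remaining
exponent 3/2 keeps the sum over n convergent. -/
theorem one_div_mul_le_rpow {a b M : ℝ} (ha : 0 < a) (hb : 0 < b) (hM : 0 < M) (h : M ≤ a + b) :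
    1 / (a * b) ≤ √(2 / M) * (1 / a ^ (3 / 2 : ℝ) + 1 / b ^ (3 / 2 : ℝ)) := by
  wlog hab : a ≤ b generalizing a b
  · have := this hb ha (by linarith) (by linarith)
    rwa [mul_comm b a, add_comm (1 / b ^ (3 / 2 : ℝ))] at this
  have h1 : a ^ (3 / 2 : ℝ) = a * √a := by
    rw [Real.sqrt_eq_rpow, ← Real.rpow_one_add' ha.le (by norm_num)]; norm_num
  have hsa : 0 < √a := Real.sqrt_pos.2 ha
  have hsb : 0 < √b := Real.sqrt_pos.2 hb
  have h2 : 1 / √b ≤ √(2 / M) := by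
    rw [← Real.sqrt_one, ← Real.sqrt_div (by norm_num)]
    apply Real.sqrt_le_sqrt
    rw [div_le_div_iff₀ hb hM]
    linarith
  have h3 : √a ≤ √b := Real.sqrt_le_sqrt hab
  calc 1 / (a * b) = 1 / √b * (1 / (a * √b)) := by
        rw [one_div_mul_one_div, mul_left_comm, Real.mul_self_sqrt hb.le]
    _ ≤ √(2 / M) * (1 / (a * √a)) := by gcongr
    _ ≤ _ := by
        rw [h1]
        gcongr
        exact le_add_of_nonneg_right (by positivity)

theorem exists_norm_symSum_mul_shift_le {a u : ℤ → ℂ} {A C : ℝ} (hA0 : 0 ≤ A) (hC0 : 0 ≤ C)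
    (ha : ∀ n, ‖a n‖ ≤ A / |(n : ℝ) + 1 / 2|) (hu : ∀ n, ‖u n‖ ≤ C / |(n : ℝ) + 1 / 2|) :
    ∃ B : ℝ, ∀ M N : ℕ, 1 ≤ M → ‖symSum (fun n => a n * u (n + M)) N‖ ≤ B * √(2 / M) := by
  set g : ℤ → ℝ := fun n => 1 / |(n : ℝ) + 1 / 2| ^ (3 / 2 : ℝ)
  have hg : Summable g := (Real.summable_one_div_int_add_rpow _ _).2 (by norm_num)
  have hg0 : ∀ n, 0 ≤ g n := fun n => by positivity
  have hpos : ∀ n : ℤ, 0 < |(n : ℝ) + 1 / 2| := fun n => by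
    rw [abs_pos]
    intro h
    exact half_ne_zero n (by simpa using congrArg (fun r : ℝ => (r : ℂ)) h)
  have hB : ∀ (φ : ℕ → ℤ), φ.Injective → ∀ N : ℕ, ∑ n ∈ Finset.range N, g (φ n) ≤ ∑' n, g n :=
    fun φ hφ N => by
      have := hg.sum_le_tsum ((Finset.range N).map ⟨φ, hφ⟩) (fun i _ => hg0 i)
      simpa using this
  have hterm : ∀ (n : ℤ) (M : ℕ), 1 ≤ M →
      ‖a n * u (n + M)‖ ≤ A * C * (√(2 / M) * (g n + g (n + M))) := fun n M hM => by
    have hM' : (0 : ℝ) < M := by exact_mod_cast hM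
    have h1 := one_div_mul_le_rpow (hpos n) (hpos (n + M)) hM' (by
      push_cast
      calc (M : ℝ) = |((n : ℝ) + M + 1 / 2) - (n + 1 / 2)| := by
            rw [show ((n : ℝ) + M + 1 / 2) - (n + 1 / 2) = M by ring, abs_of_pos hM']
        _ ≤ _ := (abs_sub _ _).trans (le_of_eq (add_comm _ _)))
    calc _ ≤ A / |(n : ℝ) + 1 / 2| * (C / |((n + M : ℤ) : ℝ) + 1 / 2|) := by
          rw [norm_mul]
          exact mul_le_mul (ha n) (hu _) (norm_nonneg _) (by positivity)
      _ = A * C * (1 / (|(n : ℝ) + 1 / 2| * |((n + M : ℤ) : ℝ) + 1 / 2|)) := by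
          field_simp
      _ ≤ _ := by gcongr
  refine ⟨A * C * (4 * ∑' n, g n), fun M N hM => ?_⟩
  have i1 := hB (fun n => (n : ℤ)) Nat.cast_injective N
  have i2 := hB (fun n => (n : ℤ) + M) (fun a b h => by simpa using h) N
  have i3 := hB (fun n => -((n : ℤ) + 1)) (fun a b h => by simpa using h) N
  have i4 := hB (fun n => -((n : ℤ) + 1) + M) (fun a b h => by simpa using h) N
  calc _ ≤ ∑ n ∈ Finset.range N, (A * C * (√(2 / M) * (g n + g (n + M)))
          + A * C * (√(2 / M) * (g (-((n : ℤ) + 1)) + g (-((n : ℤ) + 1) + M)))) :=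
        norm_sum_le_of_le _ fun n _ =>
          (norm_add_le _ _).trans (add_le_add (hterm _ _ hM) (hterm _ _ hM))
    _ = A * C * √(2 / M) * ((∑ n ∈ Finset.range N, g n + ∑ n ∈ Finset.range N, g (n + M))
          + (∑ n ∈ Finset.range N, g (-((n : ℤ) + 1))
            + ∑ n ∈ Finset.range N, g (-((n : ℤ) + 1) + M))) := by
        simp only [← Finset.sum_add_distrib, Finset.mul_sum]
        exact Finset.sum_congr rfl fun n _ => by ring
    _ ≤ A * C * √(2 / M) * (4 * ∑' n, g n) := by
        gcongr
        linarith
    _ = _ := by ring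

theorem norm_zpow_mul_half_pow_le {z : ℂ} (hz : ‖z‖ = 1) {q : ℕ} (hq : 1 ≤ q) (n : ℤ) :
    ‖z ^ (-(n + 1)) * (((n : ℂ) + 1 / 2)⁻¹) ^ q‖ ≤ 2 ^ (q - 1) / |(n : ℝ) + 1 / 2| := by
  obtain ⟨r, rfl⟩ : ∃ r, q = r + 1 := ⟨q - 1, by omega⟩
  have e : ‖(n : ℂ) + 1 / 2‖ = |(n : ℝ) + 1 / 2| := by
    rw [show ((n : ℂ) + 1 / 2) = ((n + 1 / 2 : ℝ) : ℂ) by push_cast; rfl, Complex.norm_real,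
      Real.norm_eq_abs]
  have h : (1 : ℝ) / 2 ≤ |(n : ℝ) + 1 / 2| := by
    rcases le_or_gt 0 n with h | h
    · have : (0 : ℝ) ≤ n := by exact_mod_cast h
      exact le_abs.2 (Or.inl (by linarith))
    · have : (n : ℝ) ≤ -1 := by exact_mod_cast (show n ≤ -1 by omega)
      exact le_abs.2 (Or.inr (by linarith))
  have h' : |(n : ℝ) + 1 / 2|⁻¹ ≤ 2 := by
    rw [inv_le_comm₀ (by linarith) two_pos]; linarith
  rw [norm_mul, norm_zpow, hz, one_zpow, one_mul, norm_pow, norm_inv, e, pow_succ,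
    add_tsub_cancel_right, div_eq_mul_inv]
  exact mul_le_mul_of_nonneg_right (pow_le_pow_left₀ (by positivity) h' r) (by positivity)

/-- Interchange of the two limits. -/
theorem tendsto_inner_limits {p q : ℕ} (hp : 1 ≤ p) (hq : 1 ≤ q) {y z : ℂ} (hy : ‖y‖ = 1)
    (hz : ‖z‖ = 1) (hpy : (p, y) ≠ (1, 1)) (hqz : (q, z) ≠ (1, 1)) {G : ℂ} {κ : ℕ → ℂ}
    (hG : Tendsto (symSum fun n => z ^ (-(n + 1)) * (((n : ℂ) + 1 / 2)⁻¹) ^ q * tail p y n)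
      atTop (𝓝 G))
    (hκ : ∀ i : ℕ, Tendsto (symSum fun n => z ^ (-(n + 1)) * (((n : ℂ) + 1 / 2)⁻¹) ^ q
        * (y ^ (n + 1 + i) * (((n + 1 + i : ℤ) : ℂ)⁻¹) ^ p)) atTop (𝓝 (κ i))) :
    Tendsto (fun M => ∑ i ∈ Finset.range M, κ i) atTop (𝓝 G) := by
  set a : ℤ → ℂ := fun n => z ^ (-(n + 1)) * (((n : ℂ) + 1 / 2)⁻¹) ^ q with ha
  set c : ℂ := Li p y + (-1) ^ p * Li p y⁻¹ with hc
  obtain ⟨C, hC0, hC⟩ := exists_norm_tail_sub_le hp hy hpy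
  obtain ⟨B, hB⟩ := exists_norm_symSum_mul_shift_le (by positivity) hC0
    (norm_zpow_mul_half_pow_le hz hq) hC
  have hneg : ∀ n : ℕ, a (-((n : ℤ) + 1)) = (-1) ^ q * (z ^ n / ((n : ℂ) + 1 / 2) ^ q) := by
    intro n
    have e3 : (((-((n : ℤ) + 1) : ℤ) : ℂ) + 1 / 2)⁻¹ = -((n : ℂ) + 1 / 2)⁻¹ := by
      rw [← inv_neg]; push_cast; congr 1; ring
    simp only [ha]
    rw [e3, show -(-((n : ℤ) + 1) + 1) = n by ring, zpow_natCast, neg_pow (_⁻¹), inv_pow]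
    ring
  set S : ℕ → ℂ := fun N => ∑ n ∈ Finset.range N, a (-((n : ℤ) + 1)) with hS
  obtain ⟨S', hS'⟩ : ∃ S', Tendsto S atTop (𝓝 S') := by
    refine ⟨_, ((tendsto_sum_range_ti hz hq hqz).const_mul ((-1) ^ q)).congr fun N => ?_⟩
    rw [Finset.mul_sum]
    exact Finset.sum_congr rfl fun n _ => (hneg n).symm
  -- The first M inner sums add up to `tail p y n - tail p y (n + M)`, so the shifted tail is
  -- exactly the error.
  have hE : ∀ M : ℕ, Tendsto (symSum fun n => a n * tail p y (n + M)) atTop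
      (𝓝 (G - ∑ i ∈ Finset.range M, κ i)) := fun M => by
    refine (hG.sub (tendsto_finsetSum _ fun i _ => hκ i)).congr fun N => ?_
    rw [← symSum_sum, ← symSum_sub]
    refine congrArg (fun g => symSum g N) (funext fun n => ?_)
    rw [← Finset.mul_sum, sum_range_tail hp]
    ring
  -- Splitting off the step function c on n + M < 0 leaves a product bounded uniformly in N; the
  -- step part is c times the remainder of the convergent series S.
  have hbound : ∀ M : ℕ, 1 ≤ M →
      ‖(G - ∑ i ∈ Finset.range M, κ i) - c * (S' - S M)‖ ≤ B * √(2 / M) := fun M hM => by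
    refine le_of_tendsto ((hE M).sub ((hS'.sub_const (S M)).const_mul c)).norm ?_
    filter_upwards [eventually_ge_atTop M] with N hN
    refine le_trans (le_of_eq ?_) (hB M N hM)
    congr 1
    have e : c * (S N - S M)
        = symSum (fun n => a n * (if n + M < 0 then c else 0)) N := by
      rw [hS, ← Finset.sum_Ico_eq_sub _ hN, Finset.mul_sum, symSum, Finset.range_eq_Ico,
        ← Finset.sum_Ico_consecutive _ (Nat.zero_le M) hN]
      rw [Finset.sum_eq_zero (s := Finset.Ico 0 M), zero_add]
      · refine Finset.sum_congr rfl fun n hn => ?_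
        have := (Finset.mem_Ico.1 hn).1
        rw [if_neg (by omega), if_pos (by omega), mul_zero, zero_add, mul_comm]
      · intro n hn
        have := (Finset.mem_Ico.1 hn).2
        rw [if_neg (by omega), if_neg (by omega), mul_zero, mul_zero, add_zero]
    rw [e, ← symSum_sub]
    refine congrArg (fun g => symSum g N) (funext fun n => ?_)
    rw [mul_sub]
  have hsqrt : Tendsto (fun M : ℕ => B * √(2 / M)) atTop (𝓝 0) := by
    have h1 : Tendsto (fun M : ℕ => (2 : ℝ) / M) atTop (𝓝 0) :=
      tendsto_const_nhds.div_atTop tendsto_natCast_atTop_atTop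
    have h2 := ((Real.continuous_sqrt.tendsto 0).comp h1).const_mul B
    simpa using h2
  have h0 : Tendsto (fun M => (G - ∑ i ∈ Finset.range M, κ i) - c * (S' - S M)) atTop (𝓝 0) :=
    squeeze_zero_norm' ((eventually_ge_atTop 1).mono hbound) hsqrt
  have h1 := (h0.add ((hS'.const_sub S').const_mul c)).const_sub G
  simpa using h1

theorem symSum_tail (p q : ℕ) (y z : ℂ) (N : ℕ) :
    symSum (fun n => z ^ (-(n + 1)) * (((n : ℂ) + 1 / 2)⁻¹) ^ q * tail p y n) N
      = Li p y * (z⁻¹ * ∑ n ∈ Finset.range N, z⁻¹ ^ n / ((n : ℂ) + 1 / 2) ^ q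
          + (-1) ^ q * ∑ n ∈ Finset.range N, z ^ n / ((n : ℂ) + 1 / 2) ^ q)
        - (z⁻¹ * RSum N p q y z⁻¹ - (-1) ^ (p + q) * RSum N p q y⁻¹ z) := by
  simp only [symSum, RSum, Finset.mul_sum, ← Finset.sum_add_distrib, ← Finset.sum_sub_distrib]
  refine Finset.sum_congr rfl fun n _ => ?_
  have e1 : z ^ (-((n : ℤ) + 1)) = z⁻¹ * z⁻¹ ^ n := by
    rw [← pow_succ', zpow_neg, inv_pow]; norm_cast
  have e2 : z ^ (-(-((n : ℤ) + 1) + 1)) = z ^ n := by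
    rw [show -(-((n : ℤ) + 1) + 1) = n by ring, zpow_natCast]
  have e3 : (((-((n : ℤ) + 1) : ℤ) : ℂ) + 1 / 2)⁻¹ = -((n : ℂ) + 1 / 2)⁻¹ := by
    rw [← inv_neg]; push_cast; congr 1; ring
  rw [e1, e2, e3, tail_natCast, tail_neg, neg_pow (_⁻¹), Int.cast_natCast, inv_pow ((n : ℂ) + 1 / 2)]
  ring

end CyclotomicEuler

open CyclotomicEuler in
/-- For `x = 1` the two brackets with `m = 0` are differences of one and the same term, hence `0`;
every other value of `Li` and `ti` below is the limit of a convergent series. -/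
theorem mainTheorem3 (x y : ℂ) (hx : IsOfFinOrder x) (hy : IsOfFinOrder y)
    (p q : ℕ) (hp : 1 ≤ p) (hq : 1 ≤ q)
    (hpy : (p, y) ≠ (1, 1)) (hqxy : (q, x * y) ≠ (1, 1)) :
    Tendsto (fun N : ℕ => RSum N p q y (x * y)⁻¹) atTop (𝓝 (R p q y (x * y)⁻¹)) ∧
    Tendsto (fun N : ℕ => RSum N p q y⁻¹ (x * y)) atTop (𝓝 (R p q y⁻¹ (x * y))) ∧
    (x * y)⁻¹ * R p q y (x * y)⁻¹ - (-1) ^ (p + q) * R p q y⁻¹ (x * y) =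
      Li p y * ti q (x * y)⁻¹
      + (-1) ^ q * (x * y)⁻¹ * Li p y * ti q (x * y)
      + (-1) ^ q * ((p + q - 1).choose p : ℂ) * (x * y)⁻¹ * ti (p + q) (x * y)
      + (-1) ^ q * (x * y)⁻¹ * ∑ m ∈ Finset.range p,
          ((p + q - m - 2).choose (q - 1) : ℂ)
            * ((-1) ^ m * Li (m + 1) x - Li (m + 1) x⁻¹)
            * ti (p + q - m - 1) (x * y)
      + (-1) ^ q * y⁻¹ * ∑ m ∈ Finset.range q,
          ((p + q - m - 2).choose (p - 1) : ℂ)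
            * ti (p + q - m - 1) y
            * ((-1) ^ m * ti (m + 1) x⁻¹ - x⁻¹ * ti (m + 1) x) := by
  have nx : ‖x‖ = 1 := hx.norm_eq_one
  have ny : ‖y‖ = 1 := hy.norm_eq_one
  have nz : ‖x * y‖ = 1 := by rw [norm_mul, nx, ny, one_mul]
  have nz' : ‖(x * y)⁻¹‖ = 1 := by rw [norm_inv, nz, inv_one]
  have z0 : x * y ≠ 0 := norm_ne_zero_iff.1 (by rw [nz]; exact one_ne_zero)
  have hR1 := tendsto_RSum ny nz' hp hq hpy (pair_inv_ne_one hqxy)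
  have hR2 := tendsto_RSum (by rw [norm_inv, ny, inv_one]) nz hp hq (pair_inv_ne_one hpy) hqxy
  refine ⟨hR1, hR2, ?_⟩
  have hG := ((((tendsto_sum_range_ti nz' hq (pair_inv_ne_one hqxy)).const_mul (x * y)⁻¹).add
    ((tendsto_sum_range_ti nz hq hqxy).const_mul ((-1) ^ q))).const_mul (Li p y)).sub
    ((hR1.const_mul (x * y)⁻¹).sub (hR2.const_mul ((-1) ^ (p + q))))
  have hlim := tendsto_inner_limits hp hq ny nz hpy hqxy
    (hG.congr fun N => (symSum_tail p q y (x * y) N).symm) (tendsto_symSum_inner nx ny hp hq)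
  have t1 := tendsto_sum_range_pfrac ny hp hpy 1
    (fun m => ti (q - m) x⁻¹ + (-1) ^ (q - m) * x⁻¹ * ti (q - m) x) q
  have t2 := tendsto_sum_range_pfrac nz hq hqxy (-1)
    (fun m => Li (p - m) x⁻¹ + (-1) ^ (p - m) * Li (p - m) x) p
  have t3 := (tendsto_sum_range_ti nz (p := p + q) (by omega)
    (fun e => by have := (Prod.mk.inj e).1; omega)).const_mul
      ((-1) ^ q * ((p + q - 1).choose p : ℂ))
  -- The two evaluations of the bilateral sum are equated here.
  have hK := tendsto_nhds_unique hlim (((t1.add t2).sub t3).congr fun M => by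
    rw [Finset.mul_sum, ← Finset.sum_add_distrib, ← Finset.sum_sub_distrib]
    refine Finset.sum_congr rfl fun i _ => ?_
    simp only [one_mul, neg_one_mul]
    rw [inv_pow _ (p + q)]
    ring)
  have s1 : ∑ m ∈ Finset.range q, (-1) ^ m * (Nat.multichoose p m : ℂ) * 1 ^ (p + m)
        * (y⁻¹ * ti (p + m) y) * (ti (q - m) x⁻¹ + (-1) ^ (q - m) * x⁻¹ * ti (q - m) x)
      = -((-1) ^ q * y⁻¹ * ∑ m ∈ Finset.range q,
          ((p + q - m - 2).choose (p - 1) : ℂ)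
            * ti (p + q - m - 1) y
            * ((-1) ^ m * ti (m + 1) x⁻¹ - x⁻¹ * ti (m + 1) x)) := by
    -- Reversing the summation makes the index follow the weight m + 1 of the bracket instead of the
    -- partial fraction coefficient.
    rw [← Finset.sum_range_reflect, Finset.mul_sum, ← Finset.sum_neg_distrib]
    refine Finset.sum_congr rfl fun m hm => ?_
    obtain ⟨d, hd⟩ := Nat.exists_eq_add_of_lt (Finset.mem_range.1 hm)
    have hsq : ((-1 : ℂ) ^ m) ^ 2 = 1 := by rw [← pow_mul, mul_comm, pow_mul]; simp
    rw [Nat.multichoose_eq, show q - 1 - m = d by omega, show q - d = m + 1 by omega,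
      show p + q - m - 2 = p + d - 1 by omega, show p + q - m - 1 = p + d by omega,
      show (p + d - 1).choose (p - 1) = (p + d - 1).choose d from
        Nat.choose_symm_of_eq_add (by omega), hd]
    linear_combination (-((-1) ^ d * ((p + d - 1).choose d : ℂ) * y⁻¹ * ti (p + d) y
      * ti (m + 1) x⁻¹)) * hsq
  have s2 : ∑ m ∈ Finset.range p, (-1) ^ m * (Nat.multichoose q m : ℂ) * (-1) ^ (q + m)
        * ((x * y)⁻¹ * ti (q + m) (x * y)) * (Li (p - m) x⁻¹ + (-1) ^ (p - m) * Li (p - m) x)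
      = -((-1) ^ q * (x * y)⁻¹ * ∑ m ∈ Finset.range p,
          ((p + q - m - 2).choose (q - 1) : ℂ)
            * ((-1) ^ m * Li (m + 1) x - Li (m + 1) x⁻¹)
            * ti (p + q - m - 1) (x * y)) := by
    rw [← Finset.sum_range_reflect, Finset.mul_sum, ← Finset.sum_neg_distrib]
    refine Finset.sum_congr rfl fun m hm => ?_
    obtain ⟨d, hd⟩ := Nat.exists_eq_add_of_lt (Finset.mem_range.1 hm)
    have hsq : ((-1 : ℂ) ^ d) ^ 2 = 1 := by rw [← pow_mul, mul_comm, pow_mul]; simp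
    rw [Nat.multichoose_eq, show p - 1 - m = d by omega, show p - d = m + 1 by omega,
      show p + q - m - 2 = q + d - 1 by omega, show p + q - m - 1 = q + d by omega,
      show (q + d - 1).choose (q - 1) = (q + d - 1).choose d from
        Nat.choose_symm_of_eq_add (by omega)]
    linear_combination ((-1) ^ q * ((q + d - 1).choose d : ℂ) * (x * y)⁻¹ * ti (q + d) (x * y)
      * (Li (m + 1) x⁻¹ - (-1) ^ m * Li (m + 1) x)) * hsq
  rw [s1, s2] at hK
  rw [inv_inv] at hK
  linear_combination -hK + Li p y * ti q (x * y)⁻¹ * inv_mul_cancel₀ z0
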